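/- Let $r\in\mathbb{Z}\setminus\{0\}$ and $M,k\in\mathbb{N}=\{1,2,\dots\}$, and write $M=2^{\mu}M_0$, $r=2^{\varrho}r_0$, $k=2^{\kappa}k_0$ with $M_0,r_0,k_0$ odd. Put $g_0:=\gcd(M_0,k_0)$, $g_1:=\gcd\left(g_0,\frac{k_0}{g_0}\right)$ and $\delta_0:=\min(\kappa,2\varrho)$; for coprime integers $a$ and $b\geq 1$ write $[a]_b$ for an inverse of $a$ modulo $b$. For $\alpha\in\mathbb{N}^4$ and $\operatorname{Im}(\tau)>0$ let $$\Theta_{r,M,\alpha}(\tau):=\sum_{n\ge 0}s_{r,M,\alpha}(n)e^{2\pi i n\tau},\qquad s_{r,M,\alpha}(n):=\#\Big\{x\in\mathbb{Z}^4:\ \sum_{j=1}^4\alpha_jx_j^2=n,\ x_j\equiv r\pmod M\text{ for all }j\Big\}.$$ Suppose that $\alpha=(1,2,4,8)$, that $h\in\mathbb{Z}$ with $\gcd(h,k)=1$, that $\gcd(M,r)\in\{1,2,4\}$, and that $\varrho\le\mu$. (1) If $g_1\neq 1$ or $\varrho<\min(\mu,\kappa-\mu)-1$, then $$-\lim_{z\to0^+}z^2\,\Theta_{r,M,\alpha}\left(\frac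 hk+\frac{iz}{k}\right)=0.$$ (2) If $g_1=1$ and $\varrho\ge\min(\mu,\kappa-\mu)-1$, then $$-\lim_{z\to0^+}z^2\,\Theta_{r,M,\alpha}\left(\frac hk+\frac{iz}{k}\right)=\begin{cases} -\dfrac{2^{2\kappa-4\mu-5}}{M_0^4}\,g_0^2\,\exp\left(\dfrac{2\pi i h r_0^2}{2^{\kappa-\delta_0}g_0}\,2^{2\varrho-\delta_0}\cdot 15\left[\dfrac{k_0}{g_0}\right]_{2^{\kappa-\delta_0}g_0}\right)&\text{if }\kappa\le 2\mu,\text{ or }\kappa=2\mu+1\text{ and }\varrho=\mu-1,\\[3mm] \dfrac{g_0^2}{M_0^4}\,\exp\left(\dfrac{2\pi i h r_0^2}{g_0}\cdot 15\left[2^{\kappa-2\mu}\dfrac{k_0}{g_0}\right]_{g_0}\right)&\text{if }\kappa\ge 2\mu+5\text{ and }\varrho=\mu,\\[3mm] 0&\text{otherwise.} \end{cases}$$ -/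

import Mathlib

/-- The number `s_{r,M,α}(n)` of `x ∈ ℤ⁴` with `∑ αⱼ xⱼ² = n` and `xⱼ ≡ r (mod M)` for all `j`.
For positive `αⱼ` the set of such `x` is finite. -/
noncomputable def repCount (r : ℤ) (M : ℕ) (α : Fin 4 → ℕ) (n : ℕ) : ℕ :=
  Set.ncard {x : Fin 4 → ℤ | ∑ j, (α j : ℤ) * x j ^ 2 = (n : ℤ) ∧ ∀ j, x j ≡ r [ZMOD (M : ℤ)]}

/-- The theta function `Θ_{r,M,α}(τ) = ∑_{n ≥ 0} s_{r,M,α}(n) q^n` with `q = e^{2πiτ}`. It is used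
on the upper half-plane, where the series converges absolutely. -/
noncomputable def thetaSeries (r : ℤ) (M : ℕ) (α : Fin 4 → ℕ) (τ : ℂ) : ℂ :=
  ∑' n : ℕ, (repCount r M α n : ℂ) * Complex.exp (2 * Real.pi * Complex.I * τ) ^ n

/-- `[a]_b`, the least non-negative inverse of `a` modulo `b` (for `b ≥ 1` and `gcd(a, b) = 1`). -/
def modInv (a b : ℕ) : ℕ := ((a : ZMod b)⁻¹).val

theorem modInv_spec {a b : ℕ} (hb : b ≠ 0) (hab : Nat.Coprime a b) :
    a * modInv a b ≡ 1 [MOD b] := by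
  haveI : NeZero b := ⟨hb⟩
  rw [← ZMod.natCast_eq_natCast_iff]
  simp [modInv, ZMod.coe_mul_inv_eq_one a hab]

open Filter Topology

/-! The congruences are coordinatewise, so `thetaSeries` is a product of four one-variable theta
series. Near `h/k` each of these is a finite combination of even Hurwitz kernels, whose functional
equation gives the leading term `z^(-1/2) * quadSum k (a*h) r M / (M * √(2*a*k))`
(`tendsto_sqrt_mul_thetaOne`). What remains is the product of four quadratic sums with coefficients
`h, 2h, 4h, 8h`.

If `g1 = 1`, split `k = (2^κ * g0) * k1`. Modulo `k1` the step `M` is a unit and the four Gauss sums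
multiply to `k1^2`, with no Jacobi symbols (`quadSum_prod_of_odd`). Modulo `g0` the summands are
constant, and `1+2+4+8 = 15` enters the phase. At the prime 2 the summands are constant, or one of
the four sums vanishes, or the product is a Gauss sum product with value `-2^(2κ+4μ+5)`. Every
vanishing, including that for `g1 ≠ 1`, comes from a translation multiplying the sum by a nontrivial
root of unity. -/

/-! ### Factorisation into one-variable theta series. -/

theorem summable_norm_pi_prod_and_tsum {n : ℕ} (f : Fin n → ℤ → ℂ)
    (hf : ∀ j, Summable fun m => ‖f j m‖) :
    (Summable fun m : Fin n → ℤ => ‖∏ j, f j (m j)‖) ∧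
      ∑' m : Fin n → ℤ, ∏ j, f j (m j) = ∏ j, ∑' m, f j m := by
  induction n with
  | zero => exact ⟨.of_finite, by simp⟩
  | succ n ih =>
    obtain ⟨h1, h2⟩ := ih (fun j => f j.succ) fun j => hf _
    constructor
    · rw [← (Fin.consEquiv fun _ : Fin (n + 1) => ℤ).summable_iff]
      refine (summable_mul_of_summable_norm (hf 0) h1).norm.congr fun x => ?_
      simp [Fin.consEquiv, Fin.prod_univ_succ]
    · rw [← (Fin.consEquiv fun _ : Fin (n + 1) => ℤ).tsum_eq, Fin.prod_univ_succ, ← h2,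
        tsum_mul_tsum_of_summable_norm (hf 0) h1]
      refine tsum_congr fun x => ?_
      simp [Fin.consEquiv, Fin.prod_univ_succ]

theorem tsum_pow_eq_tsum_card_fiber {ι : Type*} (Q : ι → ℕ) (q : ℂ)
    (hs : Summable fun i => q ^ Q i) :
    ∑' i, q ^ Q i = ∑' n : ℕ, (Set.ncard {i | Q i = n} : ℂ) * q ^ n := by
  have hs' : Summable ((fun i => q ^ Q i) ∘ Equiv.sigmaFiberEquiv Q) :=
    (Equiv.sigmaFiberEquiv Q).summable_iff.2 hs
  rw [← (Equiv.sigmaFiberEquiv Q).tsum_eq]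
  refine (hs'.tsum_sigma).trans (tsum_congr fun n => ?_)
  rw [tsum_congr (g := fun _ => q ^ n), tsum_const, nsmul_eq_mul]
  · rfl
  · rintro ⟨i, hi⟩
    simp [Equiv.sigmaFiberEquiv, hi]

theorem repCount_eq_ncard (r : ℤ) {M : ℕ} (hM : M ≠ 0) (α : Fin 4 → ℕ) (n : ℕ) :
    repCount r M α n =
      Set.ncard {m : Fin 4 → ℤ | ∑ j, α j * (r + M * m j).natAbs ^ 2 = n} := by
  have hinj : Function.Injective fun (m : Fin 4 → ℤ) j => r + (M : ℤ) * m j := by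
    intro a b hab
    ext j
    have := congrFun hab j
    simpa [hM] using this
  refine Eq.trans (congrArg Set.ncard (Set.ext fun x => ?_)) (Set.ncard_image_of_injective _ hinj)
  simp only [Set.mem_ofPred_eq, Set.mem_image]
  constructor
  · rintro ⟨h1, h2⟩
    have : ∀ j, ∃ c, x j - r = M * c := fun j => (h2 j).symm.dvd
    choose m hm using this
    refine ⟨m, ?_, ?_⟩
    · zify
      rw [← h1]
      refine Finset.sum_congr rfl fun j _ => ?_
      rw [sq_abs, ← hm]; ring
    · ext j
      rw [← hm]; ring
  · rintro ⟨m, h1, rfl⟩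
    constructor
    · rw [← h1]
      push_cast
      simp
    · intro j
      simp [Int.ModEq]

/-- The one-dimensional theta series `∑ q ^ (a x²)` over `x ≡ r (mod M)`. -/
noncomputable def thetaOne (r : ℤ) (M a : ℕ) (τ : ℂ) : ℂ :=
  ∑' m : ℤ, Complex.exp (2 * Real.pi * Complex.I * τ * (a * (r + M * m) ^ 2))

theorem summable_norm_thetaOne (r : ℤ) {M a : ℕ} (hM : M ≠ 0) (ha : a ≠ 0) {τ : ℂ}
    (hτ : 0 < τ.im) :
    Summable fun m : ℤ =>
      ‖Complex.exp (2 * Real.pi * Complex.I * τ * (a * (r + M * m) ^ 2))‖ := by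
  have hM' : (M : ℝ) ≠ 0 := by exact_mod_cast hM
  have ht : (0 : ℝ) < 2 * a * M ^ 2 * τ.im := by positivity
  refine (HurwitzZeta.hasSum_int_evenKernel (r / M) ht).summable.congr fun m => ?_
  rw [Complex.norm_exp]
  congr 1
  have : (2 * Real.pi * Complex.I * τ * (a * (r + M * m) ^ 2) : ℂ) =
      ((2 * Real.pi * (a * (r + M * m) ^ 2) : ℝ) : ℂ) * (Complex.I * τ) := by
    push_cast; ring
  rw [this, Complex.re_ofReal_mul, Complex.I_mul_re]
  field_simp
  ring

theorem thetaSeries_eq_prod (r : ℤ) {M : ℕ} (hM : M ≠ 0) {α : Fin 4 → ℕ} (hα : ∀ j, α j ≠ 0)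
    {τ : ℂ} (hτ : 0 < τ.im) :
    thetaSeries r M α τ = ∏ j, thetaOne r M (α j) τ := by
  obtain ⟨h1, h2⟩ := summable_norm_pi_prod_and_tsum
    (fun j m => Complex.exp (2 * Real.pi * Complex.I * τ * (α j * (r + M * m) ^ 2)))
    fun j => summable_norm_thetaOne r hM (hα j) hτ
  have key : ∀ m : Fin 4 → ℤ,
      ∏ j, Complex.exp (2 * Real.pi * Complex.I * τ * (α j * (r + M * m j) ^ 2)) =
        Complex.exp (2 * Real.pi * Complex.I * τ) ^
          (∑ j, α j * (r + M * m j).natAbs ^ 2) := by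
    intro m
    rw [← Complex.exp_sum, ← Complex.exp_nat_mul, ← Finset.mul_sum, mul_comm]
    congr 2
    push_cast
    refine Finset.sum_congr rfl fun j _ => ?_
    congr 1
    rw [← Int.cast_natCast (R := ℂ) (Int.natAbs _), ← Int.cast_pow, Int.natAbs_sq]
    push_cast
    ring
  have hs := h1.of_norm
  simp only [key] at h2 hs
  rw [thetaSeries]
  simp only [repCount_eq_ncard r hM]
  rw [← tsum_pow_eq_tsum_card_fiber (fun m : Fin 4 → ℤ => ∑ j, α j * (r + M * m j).natAbs ^ 2) _ hs,
    h2]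
  rfl

/-! ### Asymptotics at the cusp `h/k`. -/

/-- The functional equation turns `t → 0+` into the cosine kernel at infinity, which tends to its
constant term 1 exponentially fast. -/
theorem tendsto_sqrt_mul_evenKernel (a : UnitAddCircle) :
    Tendsto (fun t => √t * HurwitzZeta.evenKernel a t) (𝓝[>] 0) (𝓝 1) := by
  obtain ⟨p, hp, hO⟩ := HurwitzZeta.isBigO_atTop_cosKernel_sub a
  have h0 : Tendsto (fun x : ℝ => Real.exp (-p * x)) atTop (𝓝 0) := by
    refine Real.tendsto_exp_atBot.comp ?_
    exact tendsto_id.const_mul_atTop_of_neg (neg_lt_zero.2 hp)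
  have h1 : Tendsto (HurwitzZeta.cosKernel a) atTop (𝓝 1) := by
    simpa using (hO.trans_tendsto h0).add_const 1
  refine (h1.comp tendsto_inv_nhdsGT_zero).congr' ?_
  filter_upwards [self_mem_nhdsWithin] with t ht
  have ht' : √t ≠ 0 := (Real.sqrt_pos.2 ht).ne'
  rw [HurwitzZeta.evenKernel_functional_equation, ← Real.sqrt_eq_rpow]
  simp only [Function.comp, one_div]
  field_simp

/-- The quadratic sum `∑ e(b (r + M v)² / c)` over `v` modulo `c`. -/
noncomputable def quadSum (c : ℕ) [NeZero c] (b r M : ZMod c) : ℂ :=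
  ∑ v : ZMod c, ZMod.stdAddChar (b * (r + M * v) ^ 2)

/-- Write `m = l*k + v`. The root of unity coming from `h/k` depends only on `v`, and the remaining
Gaussian sum over `l` is an even kernel. -/
theorem thetaOne_eq_sum (h r : ℤ) {k M a : ℕ} [NeZero k] (hM : M ≠ 0) (ha : a ≠ 0) {z : ℝ}
    (hz : 0 < z) :
    thetaOne r M a (h / k + Complex.I * z / k) =
      ∑ v : Fin k, ZMod.stdAddChar ((a * h : ZMod k) * (r + M * (v : ℕ) : ZMod k) ^ 2) *
        (HurwitzZeta.evenKernel ((r + M * ((v : ℕ) : ℝ)) / (M * k) : ℝ) (2 * a * M ^ 2 * k * z) : ℂ) := by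
  have hk : (k : ℂ) ≠ 0 := NeZero.ne _
  have hM' : (M : ℂ) ≠ 0 := by exact_mod_cast hM
  have hkpos : 0 < (k : ℝ) := Nat.cast_pos.2 (NeZero.pos k)
  have him : 0 < (h / k + Complex.I * z / k : ℂ).im := by
    have : (h / k + Complex.I * z / k : ℂ) = ((h / k : ℝ) : ℂ) + ((z / k : ℝ) : ℂ) * Complex.I := by
      push_cast; ring
    rw [this]
    simpa using div_pos hz hkpos
  have ht : (0 : ℝ) < 2 * a * M ^ 2 * k * z := by positivity
  have hs := (summable_norm_thetaOne r hM ha him).of_norm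
  rw [thetaOne, ← (Int.divModEquiv k).symm.tsum_eq, ← (Equiv.prodComm _ _).tsum_eq]
  rw [← (Int.divModEquiv k).symm.summable_iff, ← (Equiv.prodComm _ _).summable_iff] at hs
  refine (hs.tsum_prod).trans ?_
  rw [tsum_fintype]
  refine Finset.sum_congr rfl fun v _ => ?_
  have hK := HurwitzZeta.hasSum_int_evenKernel ((r + M * ((v : ℕ) : ℝ)) / (M * k) : ℝ) ht
  rw [← Complex.hasSum_ofReal] at hK
  rw [← hK.tsum_eq, ← tsum_mul_left]
  refine tsum_congr fun l => ?_
  have hc : ((a * h : ZMod k) * (r + M * (v : ℕ) : ZMod k) ^ 2) =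
      ((a * h * (r + M * (l * k + (v : ℕ))) ^ 2 : ℤ) : ZMod k) := by
    push_cast; simp
  rw [hc, ZMod.stdAddChar_coe, Complex.ofReal_exp, ← Complex.exp_add]
  have hval : (Int.divModEquiv k).symm ((Equiv.prodComm (Fin k) ℤ) (v, l)) =
      l * k + (v : ℕ) := rfl
  simp only [Function.comp_apply, hval]
  congr 1
  push_cast
  field_simp
  linear_combination ((z : ℂ) * (r + M * (l * k + (v : ℕ))) ^ 2) * Complex.I_sq

theorem tendsto_sqrt_mul_thetaOne (h r : ℤ) {k M a : ℕ} [NeZero k] (hM : M ≠ 0) (ha : a ≠ 0) :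
    Tendsto (fun z : ℝ => (√z : ℂ) * thetaOne r M a (h / k + Complex.I * z / k)) (𝓝[>] 0)
      (𝓝 (quadSum k (a * h) r M / (M * (√(2 * a * k) : ℝ)))) := by
  have hkpos : 0 < (k : ℝ) := Nat.cast_pos.2 (NeZero.pos k)
  have hMpos : 0 < (M : ℝ) := by positivity
  have hapos : 0 < (a : ℝ) := by positivity
  have hc : (0 : ℝ) < 2 * a * M ^ 2 * k := by positivity
  have hmul : Tendsto (fun z : ℝ => 2 * a * M ^ 2 * k * z) (𝓝[>] 0) (𝓝[>] 0) := by
    refine tendsto_nhdsWithin_iff.2 ⟨?_, ?_⟩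
    · refine tendsto_nhdsWithin_of_tendsto_nhds ?_
      simpa using (continuous_const_mul (2 * a * M ^ 2 * k : ℝ)).tendsto 0
    · filter_upwards [self_mem_nhdsWithin] with z hz
      exact mul_pos hc hz
  have hsq : √(2 * a * M ^ 2 * k : ℝ) = M * √(2 * a * k) := by
    rw [show (2 * a * M ^ 2 * k : ℝ) = M ^ 2 * (2 * a * k) by ring, Real.sqrt_mul (by positivity),
      Real.sqrt_sq hMpos.le]
  have hlim : Tendsto (fun z : ℝ => ∑ v : Fin k,
      ZMod.stdAddChar ((a * h : ZMod k) * (r + M * (v : ℕ) : ZMod k) ^ 2) / (M * (√(2 * a * k) : ℝ)) *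
        ((√(2 * a * M ^ 2 * k * z) * HurwitzZeta.evenKernel
          ((r + M * ((v : ℕ) : ℝ)) / (M * k) : ℝ) (2 * a * M ^ 2 * k * z) : ℝ) : ℂ)) (𝓝[>] 0)
      (𝓝 (∑ v : Fin k, ZMod.stdAddChar ((a * h : ZMod k) * (r + M * (v : ℕ) : ZMod k) ^ 2) /
        (M * (√(2 * a * k) : ℝ)) * ((1 : ℝ) : ℂ))) := by
    refine tendsto_finsetSum _ fun v _ => Tendsto.const_mul _ ?_
    exact (Complex.continuous_ofReal.tendsto _).comp ((tendsto_sqrt_mul_evenKernel _).comp hmul)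
  have hval : (∑ v : Fin k, ZMod.stdAddChar ((a * h : ZMod k) * (r + M * (v : ℕ) : ZMod k) ^ 2) /
        (M * (√(2 * a * k) : ℝ)) * ((1 : ℝ) : ℂ)) =
      quadSum k (a * h) r M / (M * (√(2 * a * k) : ℝ)) := by
    rw [quadSum, Finset.sum_div]
    refine Fintype.sum_bijective (fun v : Fin k => ((v : ℕ) : ZMod k)) ?_ _ _ fun v => by simp
    rw [Fintype.bijective_iff_injective_and_card]
    refine ⟨fun v w hvw => ?_, by simp [ZMod.card]⟩
    have := (ZMod.natCast_eq_natCast_iff' _ _ _).1 hvw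
    rw [Nat.mod_eq_of_lt v.2, Nat.mod_eq_of_lt w.2] at this
    exact Fin.ext this
  rw [hval] at hlim
  refine hlim.congr' ?_
  filter_upwards [self_mem_nhdsWithin] with z hz
  rw [thetaOne_eq_sum h r hM ha hz, Finset.mul_sum]
  refine Finset.sum_congr rfl fun v _ => ?_
  rw [Real.sqrt_mul hc.le, hsq]
  have h1 : ((√(2 * a * k) : ℝ) : ℂ) ≠ 0 := by
    exact_mod_cast (Real.sqrt_pos.2 (mul_pos (mul_pos two_pos hapos) hkpos)).ne'
  have h2 : (M : ℂ) ≠ 0 := by exact_mod_cast hM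
  push_cast
  field_simp

theorem tendsto_sq_mul_thetaSeries (h r : ℤ) {k M : ℕ} [NeZero k] (hM : M ≠ 0) :
    Tendsto (fun z : ℝ => -((z : ℂ) ^ 2 *
        thetaSeries r M ![1, 2, 4, 8] ((h : ℂ) / (k : ℂ) + Complex.I * (z : ℂ) / (k : ℂ))))
      (𝓝[>] 0)
      (𝓝 (-((quadSum k h r M * quadSum k (2 * h) r M * quadSum k (4 * h) r M *
        quadSum k (8 * h) r M) / (32 * M ^ 4 * k ^ 2)))) := by
  have hkpos : 0 < (k : ℝ) := Nat.cast_pos.2 (NeZero.pos k)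
  have H := fun a ha => tendsto_sqrt_mul_thetaOne h r (k := k) (M := M) (a := a) hM ha
  have H4 := ((((H 1 (by simp)).mul (H 2 (by simp))).mul (H 4 (by simp))).mul (H 8 (by simp))).neg
  -- The product of the four normalisations: `2·4·8·16 = 32^2`.
  have hs : (√(2 * k) * √(2 * 2 * k) * √(2 * 4 * k) * √(2 * 8 * k) : ℝ) = 32 * k ^ 2 := by
    rw [← Real.sqrt_mul (by positivity), ← Real.sqrt_mul (by positivity),
      ← Real.sqrt_mul (by positivity),
      show (2 * k * (2 * 2 * k) * (2 * 4 * k) * (2 * 8 * k) : ℝ) = (32 * k ^ 2) ^ 2 by ring,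
      Real.sqrt_sq (by positivity)]
  have hs' : ((√(2 * k) : ℝ) * (√(2 * 2 * k) : ℝ) * (√(2 * 4 * k) : ℝ) * (√(2 * 8 * k) : ℝ) : ℂ) =
      32 * k ^ 2 := by exact_mod_cast hs
  convert H4.congr' ?_ using 2
  · push_cast
    simp only [one_mul, mul_one, div_mul_div_comm]
    congr 2
    linear_combination (-(M : ℂ) ^ 4) * hs'
  · filter_upwards [self_mem_nhdsWithin] with z hz
    have him : 0 < (h / k + Complex.I * z / k : ℂ).im := by
      have : (h / k + Complex.I * z / k : ℂ) =
          ((h / k : ℝ) : ℂ) + ((z / k : ℝ) : ℂ) * Complex.I := by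
        push_cast; ring
      rw [this]
      simpa using div_pos hz hkpos
    rw [thetaSeries_eq_prod r hM (by intro j; fin_cases j <;> simp) him, Fin.prod_univ_four]
    have hz2 : ((√z : ℝ) : ℂ) ^ 2 = z := by exact_mod_cast Real.sq_sqrt (le_of_lt hz)
    simp only [Matrix.cons_val]
    rw [← hz2]
    ring

/-! ### General reductions of quadratic sums. -/

theorem ZMod.sum_eq_sum_range (c : ℕ) [NeZero c] (f : ZMod c → ℂ) :
    ∑ v, f v = ∑ i ∈ Finset.range c, f (i : ZMod c) := by
  rw [← Fin.sum_univ_eq_sum_range (fun i => f (i : ZMod c))]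
  symm
  refine Fintype.sum_bijective (fun v : Fin c => ((v : ℕ) : ZMod c)) ?_ _ _ fun v => rfl
  rw [Fintype.bijective_iff_injective_and_card]
  refine ⟨fun v w hvw => ?_, by simp [ZMod.card]⟩
  have := (ZMod.natCast_eq_natCast_iff' _ _ _).1 hvw
  rw [Nat.mod_eq_of_lt v.2, Nat.mod_eq_of_lt w.2] at this
  exact Fin.ext this

theorem Finset.sum_range_mul_of_periodic {n : ℕ} (f : ℕ → ℂ) (hf : ∀ i, f (n + i) = f i) (d : ℕ) :
    ∑ i ∈ range (d * n), f i = d * ∑ i ∈ range n, f i := by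
  have hper : ∀ e i, f (e * n + i) = f i := by
    intro e
    induction e with
    | zero => simp
    | succ e ih => intro i; rw [show (e + 1) * n + i = n + (e * n + i) by ring, hf, ih]
  induction d with
  | zero => simp
  | succ d ih =>
    rw [add_mul, one_mul, Finset.sum_range_add, ih]
    simp only [hper]
    push_cast; ring

/-- The translation `v ↦ v + t` changes the argument by an amount independent of `v`, since the
cross term dies by `h1`. The sum therefore equals itself times a character value different from 1.
-/
theorem quadSum_eq_zero_of_shift {c : ℕ} [NeZero c] {b r M t : ZMod c}
    (h1 : 2 * b * M ^ 2 * t = 0) (h2 : b * (2 * r * M * t + M ^ 2 * t ^ 2) ≠ 0) :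
    quadSum c b r M = 0 := by
  set χ := (ZMod.stdAddChar : AddChar (ZMod c) ℂ)
  have hne : χ (b * (2 * r * M * t + M ^ 2 * t ^ 2)) ≠ 1 := fun hh =>
    h2 (ZMod.injective_stdAddChar (hh.trans (AddChar.map_zero_eq_one χ).symm))
  have key : quadSum c b r M =
      quadSum c b r M * χ (b * (2 * r * M * t + M ^ 2 * t ^ 2)) := by
    conv_lhs => rw [quadSum, ← Equiv.sum_comp (Equiv.addRight t)]
    rw [quadSum, Finset.sum_mul]
    refine Finset.sum_congr rfl fun v _ => ?_
    rw [← AddChar.map_add_eq_mul]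
    congr 1
    simp only [Equiv.coe_addRight]
    linear_combination v * h1
  by_contra hS
  exact hne (mul_left_cancel₀ hS (by rw [mul_one]; exact key.symm))

/-- Partial fractions: `1/(m*n) ≡ u/m + w/n` modulo 1. -/
theorem stdAddChar_mul_of_coprime {c m n : ℕ} [NeZero c] [NeZero m] [NeZero n] (hc : c = m * n)
    (hmn : m.Coprime n) {u w : ℤ} (hu : (u * n : ZMod m) = 1) (hw : (w * m : ZMod n) = 1) (x : ℤ) :
    (ZMod.stdAddChar (x : ZMod c) : ℂ) =
      ZMod.stdAddChar (u * x : ZMod m) * ZMod.stdAddChar (w * x : ZMod n) := by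
  have h1 : (m : ℤ) ∣ u * n + w * m - 1 := by
    rw [← ZMod.intCast_zmod_eq_zero_iff_dvd]; push_cast; simp [hu]
  have h2 : (n : ℤ) ∣ u * n + w * m - 1 := by
    rw [← ZMod.intCast_zmod_eq_zero_iff_dvd]; push_cast; simp [hw]
  obtain ⟨q, hq⟩ := (Nat.isCoprime_iff_coprime.2 hmn).mul_dvd h1 h2
  have hm0 : (m : ℂ) ≠ 0 := NeZero.ne _
  have hn0 : (n : ℂ) ≠ 0 := NeZero.ne _
  rw [← Int.cast_mul, ← Int.cast_mul, ZMod.stdAddChar_coe, ZMod.stdAddChar_coe,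
    ZMod.stdAddChar_coe, ← Complex.exp_add, eq_comm, Complex.exp_eq_exp_iff_exists_int]
  refine ⟨q * x, ?_⟩
  have hq' : (u * n + w * m - 1 : ℂ) = m * n * q := by exact_mod_cast hq
  rw [hc]
  push_cast
  field_simp
  linear_combination (x : ℂ) * hq'

theorem quadSum_mul_of_coprime {c m n : ℕ} [NeZero c] [NeZero m] [NeZero n] (hc : c = m * n)
    (hmn : m.Coprime n) {u w : ℤ} (hu : (u * n : ZMod m) = 1) (hw : (w * m : ZMod n) = 1)
    (b r M : ℤ) :
    quadSum c b r M = quadSum m (b * u) r M * quadSum n (b * w) r M := by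
  subst hc
  simp only [quadSum]
  rw [Finset.sum_mul_sum, ← Finset.sum_product', Finset.univ_product_univ,
    ← (ZMod.chineseRemainder hmn).toEquiv.sum_comp]
  refine Finset.sum_congr rfl fun v _ => ?_
  obtain ⟨V, rfl⟩ := ZMod.intCast_surjective v
  have := stdAddChar_mul_of_coprime rfl hmn hu hw (b * (r + M * V) ^ 2)
  push_cast at this
  rw [this]
  simp only [RingEquiv.toEquiv_eq_coe, EquivLike.coe_coe, map_intCast, Prod.fst_intCast,
    Prod.snd_intCast]
  congr 2 <;> ring

theorem quadSum_of_isUnit {c : ℕ} [NeZero c] (b r : ZMod c) {M : ZMod c} (hM : IsUnit M) :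
    quadSum c b r M = quadSum c b 0 1 := by
  obtain ⟨M, rfl⟩ := hM
  simp only [quadSum, zero_add, one_mul]
  exact Equiv.sum_comp ((Units.mulLeft M).trans (Equiv.addLeft r))
    fun v => (ZMod.stdAddChar (b * v ^ 2) : ℂ)

theorem quadSum_mul_left {c d n : ℕ} [NeZero c] [NeZero n] (hc : c = d * n) (b r M : ℤ) :
    quadSum c (d * b) r M = d * quadSum n b r M := by
  have hc0 : (c : ℂ) ≠ 0 := NeZero.ne _
  have hn0 : (n : ℂ) ≠ 0 := NeZero.ne _
  have hd0 : (d : ℂ) ≠ 0 := by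
    intro h; apply hc0; rw [hc]; push_cast; rw [h, zero_mul]
  subst hc
  simp only [quadSum, ZMod.sum_eq_sum_range]
  rw [← Finset.sum_range_mul_of_periodic _ (by simp)]
  refine Finset.sum_congr rfl fun i _ => ?_
  have h1 := ZMod.stdAddChar_coe (N := d * n) (d * (b * (r + M * i) ^ 2))
  have h2 := ZMod.stdAddChar_coe (N := n) (b * (r + M * i) ^ 2)
  push_cast at h1 h2 hc0
  rw [h2, mul_assoc]
  refine h1.trans ?_
  congr 1
  field_simp

/-- Run through the residues twice and sort by parity; the double range makes this valid for every
`c`, even or odd. -/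
theorem two_mul_quadSum {c : ℕ} [NeZero c] (b : ZMod c) :
    2 * quadSum c b 0 1 = quadSum c b 0 2 + quadSum c b 1 2 := by
  have h := Finset.sum_range_mul_of_periodic (n := c)
    (fun i => ZMod.stdAddChar (b * (i : ZMod c) ^ 2)) (by simp) 2
  have h2 : ∀ (f : ℕ → ℂ) n, ∑ i ∈ Finset.range (2 * n), f i =
      ∑ i ∈ Finset.range n, (f (2 * i) + f (2 * i + 1)) := by
    intro f n
    induction n with
    | zero => simp
    | succ n ih =>
      rw [mul_add, mul_one, Finset.sum_range_succ, Finset.sum_range_succ, ih,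
        Finset.sum_range_succ]
      ring
  rw [h2, Finset.sum_add_distrib] at h
  simp only [quadSum, ZMod.sum_eq_sum_range]
  push_cast at h
  simp only [zero_add, one_mul]
  rw [← h]
  simp only [add_comm]

theorem quadSum_const {c : ℕ} [NeZero c] {b r M : ZMod c}
    (h : ∀ v, b * (2 * r * M * v + M ^ 2 * v ^ 2) = 0) :
    quadSum c b r M = c * ZMod.stdAddChar (b * r ^ 2) := by
  rw [quadSum, Finset.sum_congr rfl (g := fun _ => ZMod.stdAddChar (b * r ^ 2))]
  · simp [ZMod.card]
  · intro v _
    congr 1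
    linear_combination h v

/-! ### Gauss sums to an odd modulus. -/

section OddModulus

variable {c : ℕ} [NeZero c]

theorem quadSum_mul_sq (b : ZMod c) {u : ZMod c} (hu : IsUnit u) :
    quadSum c (b * u ^ 2) 0 1 = quadSum c b 0 1 := by
  rw [← quadSum_of_isUnit b 0 hu]
  simp only [quadSum]
  refine Finset.sum_congr rfl fun v _ => ?_
  congr 1; ring

/-- The square of the sum belongs to the form `x^2 + y^2`. Multiplication by the Gaussian integer `u
+ iw` scales this form by `u^2 + w^2` and is bijective when that norm is a unit. -/
theorem quadSum_sq_mul_add_sq (b : ZMod c) {u w : ZMod c} (h : IsUnit (u ^ 2 + w ^ 2)) :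
    quadSum c (b * (u ^ 2 + w ^ 2)) 0 1 ^ 2 = quadSum c b 0 1 ^ 2 := by
  have hG : ∀ b, quadSum c b 0 1 ^ 2 =
      ∑ p : ZMod c × ZMod c, (ZMod.stdAddChar (b * (p.1 ^ 2 + p.2 ^ 2)) : ℂ) := by
    intro b
    rw [sq, quadSum, Finset.sum_mul_sum, ← Finset.sum_product', Finset.univ_product_univ]
    refine Finset.sum_congr rfl fun p _ => ?_
    rw [← AddChar.map_add_eq_mul]
    congr 1; ring
  rw [hG, hG]
  refine Fintype.sum_bijective (fun p => (u * p.1 - w * p.2, w * p.1 + u * p.2)) ?_ _ _ ?_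
  · rw [Fintype.bijective_iff_injective_and_card]
    refine ⟨?_, rfl⟩
    rintro ⟨x, y⟩ ⟨x', y'⟩ hxy
    simp only [Prod.mk.injEq] at hxy ⊢
    obtain ⟨h1, h2⟩ := hxy
    exact ⟨h.mul_left_cancel (by linear_combination u * h1 + w * h2),
      h.mul_left_cancel (by linear_combination u * h2 - w * h1)⟩
  · rintro ⟨x, y⟩
    congr 1; ring

/-- Substitute `x = y + t` in `x^2 - y^2`: the sum over `y` is then linear and, by orthogonality,
only `t = 0` survives. -/
theorem quadSum_mul_quadSum_neg {b : ZMod c} (hb : IsUnit b) (h2 : IsUnit (2 : ZMod c)) :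
    quadSum c b 0 1 * quadSum c (-b) 0 1 = c := by
  have hstep : quadSum c b 0 1 * quadSum c (-b) 0 1 =
      ∑ t : ZMod c, ZMod.stdAddChar (b * t ^ 2) * ∑ y : ZMod c, ZMod.stdAddChar (y * (2 * b * t)) := by
    rw [quadSum, quadSum, Finset.sum_mul_sum, Finset.sum_comm]
    simp only [Finset.mul_sum]
    refine Eq.trans ?_ Finset.sum_comm
    refine Finset.sum_congr rfl fun y _ => ?_
    rw [← Equiv.sum_comp (Equiv.addLeft y)]
    refine Finset.sum_congr rfl fun t _ => ?_
    rw [← AddChar.map_add_eq_mul, ← AddChar.map_add_eq_mul]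
    congr 1
    simp only [Equiv.coe_addLeft]
    ring
  rw [hstep, Finset.sum_eq_single 0]
  · rw [AddChar.sum_mulShift _ (ZMod.isPrimitive_stdAddChar c)]
    simp [ZMod.card]
  · intro t _ ht
    rw [AddChar.sum_mulShift _ (ZMod.isPrimitive_stdAddChar c), if_neg, Nat.cast_zero, mul_zero]
    rwa [(h2.mul hb).mul_right_eq_zero]
  · simp

/-- Dirichlet supplies a prime `p ≡ 1 (mod 4)` with `p ≡ -1 (mod c)`, and Fermat writes `p` as a sum
of two squares. No factorisation of `c` is needed. -/
theorem ZMod.exists_neg_one_eq_sq_add_sq (hc : Odd c) : ∃ u w : ZMod c, -1 = u ^ 2 + w ^ 2 := by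
  have hcop : Nat.Coprime 4 c := by
    rw [show 4 = 2 ^ 2 by norm_num]
    exact Nat.Coprime.pow_left _ (Nat.coprime_two_left.2 hc)
  obtain ⟨a, ha4, hac⟩ := Nat.chineseRemainder hcop 1 (c - 1)
  have hc1 : 1 ≤ c := NeZero.one_le
  have hcop' : Nat.Coprime a (4 * c) := by
    refine Nat.Coprime.mul_right ?_ ?_
    · have := Nat.ModEq.gcd_eq ha4; simpa [Nat.Coprime] using this
    · have := Nat.ModEq.gcd_eq hac
      rw [Nat.Coprime, this]
      have : Nat.Coprime (c - 1) (c - 1 + 1) := by simp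
      rwa [Nat.sub_add_cancel hc1] at this
  have : NeZero (4 * c) := ⟨by positivity⟩
  obtain ⟨p, -, hp, hpa⟩ := Nat.forall_exists_prime_gt_and_eq_mod
    ((ZMod.isUnit_iff_coprime a (4 * c)).2 hcop') 0
  have hpm := (ZMod.natCast_eq_natCast_iff _ _ _).1 hpa
  have hp4 : p % 4 = 1 := (Nat.ModEq.of_mul_right c hpm).trans ha4
  have hpc : p ≡ c - 1 [MOD c] := (Nat.ModEq.of_mul_left 4 hpm).trans hac
  have := Fact.mk hp
  obtain ⟨x, y, hxy⟩ := Nat.Prime.sq_add_sq (p := p) (by omega)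
  refine ⟨x, y, ?_⟩
  have := (ZMod.natCast_eq_natCast_iff _ _ _).2 hpc
  rw [← hxy, Nat.cast_sub hc1] at this
  push_cast at this
  rw [this]; simp

/-- With `G(b)` the sum: `G(4b) = G(b)` and `G(8b) = G(2b)` because 4 is a square. Since `2 = 1 + 1`
and `-1` are sums of two squares, `G(2b)^2 = G(b)^2 = G(-b)^2`. The product is thus `(G(b)
G(-b))^2`. -/
theorem quadSum_prod_of_odd (hc : Odd c) {b : ZMod c} (hb : IsUnit b) :
    quadSum c b 0 1 * quadSum c (2 * b) 0 1 * quadSum c (4 * b) 0 1 * quadSum c (8 * b) 0 1 =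
      c ^ 2 := by
  have h2 : IsUnit (2 : ZMod c) := by
    exact_mod_cast (ZMod.isUnit_iff_coprime 2 c).2 (Nat.coprime_two_left.2 hc)
  obtain ⟨u, w, huw⟩ := ZMod.exists_neg_one_eq_sq_add_sq hc
  have e4 : quadSum c (4 * b) 0 1 = quadSum c b 0 1 := by
    rw [← quadSum_mul_sq b h2]; congr 1; ring
  have e8 : quadSum c (8 * b) 0 1 = quadSum c (2 * b) 0 1 := by
    rw [← quadSum_mul_sq (2 * b) h2]; congr 1; ring
  have e2 : quadSum c (2 * b) 0 1 ^ 2 = quadSum c b 0 1 ^ 2 := by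
    rw [← quadSum_sq_mul_add_sq b (u := 1) (w := 1) (by norm_num [h2])]
    congr 2; ring
  have en : quadSum c (-b) 0 1 ^ 2 = quadSum c b 0 1 ^ 2 := by
    rw [← quadSum_sq_mul_add_sq b (u := u) (w := w) (by rw [← huw]; exact isUnit_one.neg), ← huw,
      mul_neg_one]
  rw [e4, e8, ← quadSum_mul_quadSum_neg hb h2]
  linear_combination quadSum c b 0 1 ^ 2 * e2 - quadSum c b 0 1 ^ 2 * en

end OddModulus

/-! ### Integer forms of the vanishing criterion. -/

theorem quadSum_eq_zero_of_dvd {k : ℕ} [NeZero k] {b r M t : ℤ} (h1 : (k : ℤ) ∣ 2 * b * M ^ 2 * t)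
    (h2 : ¬ (k : ℤ) ∣ b * (2 * r * M * t + M ^ 2 * t ^ 2)) : quadSum k b r M = 0 := by
  apply quadSum_eq_zero_of_shift (t := (t : ZMod k))
  · rw [← ZMod.intCast_zmod_eq_zero_iff_dvd] at h1
    exact_mod_cast h1
  · rw [← ZMod.intCast_zmod_eq_zero_iff_dvd] at h2
    exact_mod_cast h2

/-- Here the translation changes the argument by an odd multiple of half the modulus, so the factor
is `-1`. -/
theorem quadSum_eq_zero_of_half {k : ℕ} [NeZero k] {b r M t n : ℤ}
    (h1 : (k : ℤ) ∣ 2 * b * M ^ 2 * t) (hn : Odd n)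
    (h2 : 2 * (b * (2 * r * M * t + M ^ 2 * t ^ 2)) = k * n) : quadSum k b r M = 0 := by
  refine quadSum_eq_zero_of_dvd h1 ?_
  rintro ⟨q, hq⟩
  have hk : (k : ℤ) ≠ 0 := NeZero.ne _
  rw [hq] at h2
  have : n = 2 * q := mul_left_cancel₀ hk (by linear_combination -h2)
  rw [this] at hn
  exact (Int.not_odd_iff_even.2 (even_two_mul q)) hn

/-! ### Gauss sums modulo powers of two. -/

section TwoPower

/-- Split by parity: the odd residues contribute zero by a translation, and the even ones reduce to
a quarter of the modulus. -/
theorem quadSum_two_pow_add_four (n : ℕ) {o : ℤ} (ho : Odd o) :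
    quadSum (2 ^ (n + 4)) o 0 1 = 2 * quadSum (2 ^ (n + 2)) o 0 1 := by
  have h := two_mul_quadSum (c := 2 ^ (n + 4)) o
  have h1 : quadSum (2 ^ (n + 4)) o 1 2 = 0 := by
    have := quadSum_eq_zero_of_half (k := 2 ^ (n + 4)) (b := o) (r := 1) (M := 2)
      (t := 2 ^ (n + 1)) (n := o * (1 + 2 ^ (n + 1))) ⟨o, by push_cast; ring⟩
      (ho.mul (by rw [pow_succ']; exact odd_one.add_even (even_two_mul _))) (by push_cast; ring)
    simpa using this
  have h2 : quadSum (2 ^ (n + 4)) o 0 2 = 4 * quadSum (2 ^ (n + 2)) o 0 1 := by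
    have := quadSum_mul_left (c := 2 ^ (n + 4)) (d := 4) (n := 2 ^ (n + 2)) (by ring) o 0 1
    push_cast at this
    rw [← this]
    simp only [quadSum]
    refine Finset.sum_congr rfl fun v _ => ?_
    congr 1; ring
  rw [h1, h2] at h
  linear_combination h / 2

/-- The sums are `4e` and `2 + 2f` with `e^2 = f` and `f^2 = -1`. Squaring the product removes the
dependence on `o`. -/
theorem quadSum_four_mul_quadSum_eight_sq {o : ℤ} (ho : Odd o) :
    (quadSum (2 ^ 3) o 0 1 * quadSum (2 ^ 2) o 0 1) ^ 2 = -128 := by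
  obtain ⟨j, hj⟩ := ho
  set e : ℂ := ZMod.stdAddChar (o : ZMod (2 ^ 3)) with he
  set f : ℂ := ZMod.stdAddChar (o : ZMod (2 ^ 2)) with hf
  have hef : e ^ 2 = f := by
    rw [he, hf, ZMod.stdAddChar_coe, ZMod.stdAddChar_coe, ← Complex.exp_nat_mul]
    congr 1; push_cast; ring
  have hf2 : f ^ 2 = -1 := by
    rw [hf, ZMod.stdAddChar_coe, ← Complex.exp_nat_mul, hj,
      show ((2 : ℕ) * (2 * Real.pi * Complex.I * ((2 * j + 1 : ℤ) : ℂ) / ((2 ^ 2 : ℕ) : ℂ)) : ℂ) =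
        Real.pi * Complex.I + j * (2 * Real.pi * Complex.I) by push_cast; ring,
      Complex.exp_add, Complex.exp_pi_mul_I, Complex.exp_int_mul_two_pi_mul_I, mul_one]
  have hpow : ∀ (n i : ℕ), (ZMod.stdAddChar ((o : ZMod (2 ^ n)) * (0 + 1 * (i : ZMod (2 ^ n))) ^ 2) : ℂ)
      = ZMod.stdAddChar (o : ZMod (2 ^ n)) ^ (i ^ 2) := by
    intro n i
    rw [← AddChar.map_nsmul_eq_pow]
    congr 1
    simp [mul_comm]
  have h3 : quadSum (2 ^ 3) o 0 1 = 4 * e := by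
    have e4 : e ^ 4 = -1 := by rw [← hf2, ← hef]; ring
    rw [quadSum, ZMod.sum_eq_sum_range]
    simp only [hpow]
    rw [← he, show Finset.range (2 ^ 3) = Finset.range 8 from rfl]
    simp only [Finset.sum_range_succ, Finset.sum_range_zero]
    ring_nf
    rw [show e ^ 49 = e * (e ^ 4) ^ 12 by ring, show e ^ 36 = (e ^ 4) ^ 9 by ring,
      show e ^ 25 = e * (e ^ 4) ^ 6 by ring, show e ^ 16 = (e ^ 4) ^ 4 by ring,
      show e ^ 9 = e * (e ^ 4) ^ 2 by ring, e4]
    ring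
  have h2 : quadSum (2 ^ 2) o 0 1 = 2 + 2 * f := by
    rw [quadSum, ZMod.sum_eq_sum_range]
    simp only [hpow]
    rw [← hf, show Finset.range (2 ^ 2) = Finset.range 4 from rfl]
    simp only [Finset.sum_range_succ, Finset.sum_range_zero]
    ring_nf
    rw [show f ^ 9 = f * (f ^ 2) ^ 4 by ring, show f ^ 4 = (f ^ 2) ^ 2 by ring, hf2]
    ring
  rw [h3, h2]
  linear_combination (64 * (1 + f) ^ 2) * hef + (64 * f + 128) * hf2

theorem quadSum_two_pow_prod (n : ℕ) {o : ℤ} (ho : Odd o) :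
    quadSum (2 ^ (n + 5)) o 0 1 * quadSum (2 ^ (n + 4)) o 0 1 * quadSum (2 ^ (n + 3)) o 0 1 *
      quadSum (2 ^ (n + 2)) o 0 1 = -2 ^ (2 * n + 9) := by
  have hP : ∀ n, quadSum (2 ^ (n + 3)) o 0 1 * quadSum (2 ^ (n + 2)) o 0 1 =
      2 ^ n * (quadSum (2 ^ 3) o 0 1 * quadSum (2 ^ 2) o 0 1) := by
    intro n
    induction n with
    | zero => rw [pow_zero, one_mul]
    | succ n ih =>
      change quadSum (2 ^ (n + 4)) o 0 1 * quadSum (2 ^ (n + 3)) o 0 1 = _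
      rw [quadSum_two_pow_add_four n ho, pow_succ (2 : ℂ)]
      linear_combination 2 * ih
  -- The two larger moduli reduce to the two smaller ones, so the fourfold product is 4 times a
  -- square.
  have h5 : quadSum (2 ^ (n + 5)) o 0 1 = 2 * quadSum (2 ^ (n + 3)) o 0 1 :=
    quadSum_two_pow_add_four (n + 1) ho
  rw [h5, quadSum_two_pow_add_four n ho]
  have h1 := hP n
  have h2 := quadSum_four_mul_quadSum_eight_sq ho
  have h3 : (quadSum (2 ^ (n + 3)) o 0 1 * quadSum (2 ^ (n + 2)) o 0 1) ^ 2 =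
      (2 ^ n) ^ 2 * (-128) := by rw [h1, mul_pow, h2]
  rw [show (2 : ℂ) ^ (2 * n + 9) = (2 ^ n) ^ 2 * 512 by rw [pow_add, pow_mul']; norm_num]
  linear_combination 4 * h3

theorem quadSum_two_pow_scale {κ μ β m : ℕ} (hκ : κ = 2 * μ + β + m) (o r0 : ℤ) {M0 : ℤ}
    (hM0 : Odd M0) :
    quadSum (2 ^ κ) (2 ^ β * o) (2 ^ μ * r0) (2 ^ μ * M0) =
      2 ^ (2 * μ + β) * quadSum (2 ^ m) o 0 1 := by
  have hunit : IsUnit (M0 : ZMod (2 ^ m)) := by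
    rw [ZMod.coe_int_isUnit_iff_isCoprime]
    push_cast
    exact (Int.isCoprime_two_left.2 hM0).pow_left
  rw [← quadSum_of_isUnit (o : ZMod (2 ^ m)) r0 hunit]
  have h := quadSum_mul_left (c := 2 ^ κ) (d := 2 ^ (2 * μ + β)) (n := 2 ^ m)
    (by rw [hκ, pow_add]) o r0 M0
  push_cast at h
  rw [← h]
  simp only [quadSum]
  refine Finset.sum_congr rfl fun v _ => ?_
  congr 1; ring

/-- Removing `2^(2μ)` and the coefficient `2^β` leaves modulus `2^(κ-2μ-β)`. The bound on `κ` keeps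
this at least 4 up to `β = 3`, as `quadSum_two_pow_prod` needs. -/
theorem quadSum_two_pow_scale_prod {κ μ : ℕ} (hκ : 2 * μ + 5 ≤ κ) {o : ℤ} (ho : Odd o) (r0 : ℤ)
    {M0 : ℤ} (hM0 : Odd M0) :
    quadSum (2 ^ κ) o (2 ^ μ * r0) (2 ^ μ * M0) * quadSum (2 ^ κ) (2 * o) (2 ^ μ * r0) (2 ^ μ * M0) *
      quadSum (2 ^ κ) (4 * o) (2 ^ μ * r0) (2 ^ μ * M0) *
      quadSum (2 ^ κ) (8 * o) (2 ^ μ * r0) (2 ^ μ * M0) = -2 ^ (2 * κ + 4 * μ + 5) := by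
  obtain ⟨n, rfl⟩ := Nat.exists_eq_add_of_le hκ
  have h0 := quadSum_two_pow_scale (κ := 2 * μ + 5 + n) (μ := μ) (β := 0) (m := n + 5) (by ring)
    o r0 hM0
  have h1 := quadSum_two_pow_scale (κ := 2 * μ + 5 + n) (μ := μ) (β := 1) (m := n + 4) (by ring)
    o r0 hM0
  have h2 := quadSum_two_pow_scale (κ := 2 * μ + 5 + n) (μ := μ) (β := 2) (m := n + 3) (by ring)
    o r0 hM0
  have h3 := quadSum_two_pow_scale (κ := 2 * μ + 5 + n) (μ := μ) (β := 3) (m := n + 2) (by ring)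
    o r0 hM0
  rw [pow_zero, one_mul] at h0
  rw [pow_one] at h1
  rw [show (2 : ZMod (2 ^ (2 * μ + 5 + n))) ^ 2 = 4 by norm_num] at h2
  rw [show (2 : ZMod (2 ^ (2 * μ + 5 + n))) ^ 3 = 8 by norm_num] at h3
  rw [h0, h1, h2, h3]
  have h := quadSum_two_pow_prod n ho
  rw [show (2 : ℂ) ^ (2 * (2 * μ + 5 + n) + 4 * μ + 5) =
    2 ^ (2 * μ + 0) * 2 ^ (2 * μ + 1) * 2 ^ (2 * μ + 2) * 2 ^ (2 * μ + 3) * 2 ^ (2 * n + 9) by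
    simp only [← pow_add]; congr 1; ring]
  linear_combination (2 ^ (2 * μ + 0) * 2 ^ (2 * μ + 1) * 2 ^ (2 * μ + 2) * 2 ^ (2 * μ + 3)) * h

end TwoPower

/-! ### Vanishing of individual sums modulo `k`. -/

section Vanishing

variable {h r0 : ℤ} {k k0 M0 κ μ ϱ : ℕ}

theorem Int.odd_of_gcd_two_pow_mul_eq_one (hk : k = 2 ^ κ * k0) (hκ : κ ≠ 0)
    (hhk : Int.gcd h k = 1) : Odd h := by
  rw [← Int.not_even_iff_odd]
  intro he
  have h2 : ((2 : ℕ) : ℤ) ∣ (Int.gcd h k : ℤ) := by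
    refine Int.dvd_coe_gcd (by exact_mod_cast he.two_dvd) ?_
    rw [hk]
    exact_mod_cast (dvd_pow_self 2 hκ).mul_right k0
  rw [hhk] at h2
  norm_num at h2

variable [NeZero k]

theorem quadSum_eq_zero_of_lt (hM0 : Odd M0) (hr0 : Odd r0) (hk : k = 2 ^ κ * k0)
    (hhk : Int.gcd h k = 1) (h1 : ϱ + μ + 2 ≤ κ) (h2 : ϱ + 1 ≤ μ) (h3 : 2 * ϱ + 4 ≤ κ) :
    quadSum k h ((2 ^ ϱ * r0 : ℤ)) ((2 ^ μ * M0 : ℤ)) = 0 := by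
  have hodd := Int.odd_of_gcd_two_pow_mul_eq_one hk (by omega) hhk
  obtain ⟨j, hj⟩ := Nat.exists_eq_add_of_le h1
  obtain ⟨s, hs⟩ := Nat.exists_eq_add_of_le h2
  obtain ⟨e, he⟩ := Nat.exists_eq_add_of_le h3
  have p1 : (2 : ℤ) ^ κ = 4 * (2 ^ ϱ * 2 ^ μ * 2 ^ j) := by rw [hj]; ring
  have p2 : (2 : ℤ) ^ μ * 2 ^ μ * (2 ^ j * 2 ^ j) = 2 ^ κ * 2 ^ e := by
    simp only [← pow_add]; congr 1; omega
  have p3 : 2 * ((2 : ℤ) ^ μ * 2 ^ μ * 2 ^ j) = 2 ^ κ * 2 ^ s := by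
    simp only [← pow_add, ← pow_succ']; congr 1; omega
  have hkZ : (k : ℤ) = 2 ^ κ * k0 := by rw [hk]; push_cast; ring
  have hM0' : Odd (M0 : ℤ) := by exact_mod_cast hM0
  -- With `j = κ - ϱ - μ - 2` the linear term is an odd multiple of `k/2`, while `h3` makes the
  -- quadratic term a multiple of `k`.
  refine quadSum_eq_zero_of_half (t := 2 ^ j * k0)
    (n := h * (r0 * M0 + 2 * (2 ^ e * M0 ^ 2 * k0))) ?_ ?_ ?_
  · refine ⟨h * M0 ^ 2 * 2 ^ s, ?_⟩
    rw [hkZ]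
    linear_combination (h * M0 ^ 2 * k0) * p3
  · exact hodd.mul ((hr0.mul hM0').add_even (even_two_mul _))
  · rw [hkZ]
    linear_combination (2 * h * M0 ^ 2 * k0 ^ 2) * p2 - (h * r0 * M0 * k0) * p1

theorem quadSum_eq_zero_of_eq {β : ℕ} (hM0 : Odd M0) (hk : k = 2 ^ κ * k0) (hk0 : Odd k0)
    (hhk : Int.gcd h k = 1) (hκ : κ = 2 * μ + 1 + β) :
    quadSum k ((2 ^ β * h : ℤ)) ((2 ^ μ * r0 : ℤ)) ((2 ^ μ * M0 : ℤ)) = 0 := by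
  have hodd := Int.odd_of_gcd_two_pow_mul_eq_one hk (by omega) hhk
  have hkZ : (k : ℤ) = 2 ^ κ * k0 := by rw [hk]; push_cast; ring
  have p1 : (2 : ℤ) ^ κ = 2 * (2 ^ μ * 2 ^ μ * 2 ^ β) := by rw [hκ]; ring
  have hM0' : Odd (M0 : ℤ) := by exact_mod_cast hM0
  have hk0' : Odd (k0 : ℤ) := by exact_mod_cast hk0
  -- Now the roles are reversed: the quadratic term is an odd multiple of `k/2` and the linear term
  -- is a multiple of `k`.
  refine quadSum_eq_zero_of_half (t := k0) (n := h * (2 * (r0 * M0) + M0 ^ 2 * k0)) ?_ ?_ ?_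
  · refine ⟨h * M0 ^ 2, ?_⟩
    rw [hkZ, p1]
    ring
  · exact hodd.mul ((even_two_mul _).add_odd ((hM0'.pow).mul hk0'))
  · rw [hkZ, p1]
    ring

theorem quadSum_eq_zero_of_gcd {r : ℤ} {M g0 M1 k1 g1 : ℕ} (hM : M = 2 ^ μ * M0) (hM0 : Odd M0)
    (hk : k = 2 ^ κ * k0) (hM1 : M0 = g0 * M1) (hk1 : k0 = g0 * k1) (hcop : M1.Coprime k1)
    (hg1 : g1 = Nat.gcd g0 k1) (hg1' : g1 ≠ 1) (hhk : Int.gcd h k = 1)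
    (hMr : Int.gcd M r ∣ 4) : quadSum k h r (M : ℤ) = 0 := by
  obtain ⟨a, ha⟩ : g1 ∣ g0 := hg1 ▸ Nat.gcd_dvd_left _ _
  obtain ⟨b, hb⟩ : g1 ∣ k1 := hg1 ▸ Nat.gcd_dvd_right _ _
  have hkZ : (k : ℤ) = 2 ^ κ * (g1 * a * (g1 * b)) := by rw [hk, hk1, hb, ha]; push_cast; ring
  have hMZ : (M : ℤ) = 2 ^ μ * (g1 * a * M1) := by rw [hM, hM1, ha]; push_cast; ring
  have hk0 : (k : ℤ) ≠ 0 := NeZero.ne _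
  have hoddg : Odd g1 := by
    rw [hM1, ha] at hM0
    exact (Nat.odd_mul.1 (Nat.odd_mul.1 hM0).1).1
  have hc2 : IsCoprime (g1 : ℤ) 2 := (Int.isCoprime_two_right).2 (by exact_mod_cast hoddg)
  have hcM1 : IsCoprime (g1 : ℤ) M1 := by
    rw [Nat.isCoprime_iff_coprime]
    exact (hcop.coprime_dvd_right ⟨b, hb⟩).symm
  have hch : IsCoprime (g1 : ℤ) h := by
    have : IsCoprime h (k : ℤ) := Int.isCoprime_iff_gcd_eq_one.2 hhk
    exact (this.of_isCoprime_of_dvd_right ⟨2 ^ κ * (a * (g1 * b)), by rw [hkZ]; ring⟩).symm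
  have hcr : IsCoprime (g1 : ℤ) r := by
    rw [Int.isCoprime_iff_gcd_eq_one]
    have hd4 : Int.gcd g1 r ∣ 4 := by
      refine dvd_trans ?_ hMr
      exact Int.gcd_dvd_gcd_of_dvd_left _ ⟨2 ^ μ * (a * M1), by rw [hMZ]; ring⟩
    have hdg : Int.gcd g1 r ∣ g1 := by
      have := Int.gcd_dvd_left (g1 : ℤ) r; exact_mod_cast this
    have h4 : Nat.Coprime g1 4 := by
      rw [show 4 = 2 ^ 2 by norm_num]
      exact Nat.Coprime.pow_right _ (Nat.coprime_two_right.2 hoddg)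
    exact Nat.Coprime.eq_one_of_dvd (h4.coprime_dvd_left hdg) hd4
  have hdiv : (k : ℤ) ∣ (M : ℤ) ^ 2 * (2 ^ κ * b) :=
    ⟨2 ^ μ * 2 ^ μ * a * M1 ^ 2, by rw [hkZ, hMZ]; ring⟩
  -- This `t` kills the quadratic term. The linear one survives because `g1` is coprime to `2`, `h`,
  -- `r` and `M1`.
  refine quadSum_eq_zero_of_dvd (t := 2 ^ κ * b) ?_ ?_
  · rw [mul_assoc]; exact hdiv.mul_left _
  · intro hdvd
    have h1 : (k : ℤ) ∣ h * (2 * r * M * (2 ^ κ * b)) := by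
      have := (hdiv.mul_left (h * (2 ^ κ * b)))
      refine (Int.dvd_add_left this).1 ?_
      convert hdvd using 1; ring
    obtain ⟨q, hq⟩ := h1
    have hne : (2 ^ κ * (g1 * a * b) : ℤ) ≠ 0 := by
      intro h0; apply hk0; rw [hkZ]; linear_combination (g1 : ℤ) * h0
    have hg : (g1 : ℤ) ∣ h * 2 * r * (2 ^ μ * M1) := by
      refine ⟨q, mul_left_cancel₀ hne ?_⟩
      rw [hkZ, hMZ] at hq
      linear_combination hq
    have hco : IsCoprime (g1 : ℤ) (h * 2 * r * (2 ^ μ * M1)) :=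
      ((hch.mul_right hc2).mul_right hcr).mul_right ((hc2.pow_right).mul_right hcM1)
    have := hco.isUnit_of_dvd hg
    rw [Int.isUnit_iff_natAbs_eq] at this
    exact hg1' (by simpa using this)

end Vanishing

/-! ### Products of the four sums and their phases. -/

theorem modInv_mul_cancel {a b : ℕ} (hb : b ≠ 0) (hab : Nat.Coprime a b) :
    (((modInv a b : ℕ) : ℤ) * (a : ZMod b) : ZMod b) = 1 := by
  have := (ZMod.natCast_eq_natCast_iff _ _ _).2 (modInv_spec hb hab)
  push_cast at this ⊢
  rw [mul_comm]; exact this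

theorem modInv_mul_sub_one_dvd {a b : ℕ} (hb : b ≠ 0) (hab : Nat.Coprime a b) :
    (b : ℤ) ∣ (modInv a b : ℤ) * a - 1 := by
  rw [← ZMod.intCast_zmod_eq_zero_iff_dvd]
  have := modInv_mul_cancel hb hab
  push_cast at this ⊢
  rw [this, sub_self]

theorem quadSum_prod_split {k N k1 : ℕ} [NeZero k] [NeZero N] [NeZero k1] (hk : k = N * k1)
    (hcop : N.Coprime k1) (hk1 : Odd k1) {h r M : ℤ} (hh : IsCoprime h k) (hM : IsCoprime M k1) :
    quadSum k h r M * quadSum k (2 * h) r M * quadSum k (4 * h) r M * quadSum k (8 * h) r M =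
      quadSum N (h * modInv k1 N : ℤ) r M * quadSum N (2 * (h * modInv k1 N : ℤ)) r M *
        quadSum N (4 * (h * modInv k1 N : ℤ)) r M * quadSum N (8 * (h * modInv k1 N : ℤ)) r M *
        k1 ^ 2 := by
  have hu := modInv_mul_cancel (NeZero.ne N) hcop.symm
  have hw := modInv_mul_cancel (NeZero.ne k1) hcop
  set u : ℤ := ((modInv k1 N : ℕ) : ℤ)
  set w : ℤ := ((modInv N k1 : ℕ) : ℤ)
  have hMu : IsUnit (M : ZMod k1) :=
    (ZMod.coe_int_isUnit_iff_isCoprime _ _).2 hM.symm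
  have hhu : IsUnit (h : ZMod k1) := by
    rw [ZMod.coe_int_isUnit_iff_isCoprime]
    exact (hh.of_isCoprime_of_dvd_right ⟨N, by rw [hk]; push_cast; ring⟩).symm
  have hb : IsUnit (h * w : ZMod k1) := hhu.mul (.of_mul_eq_one _ hw)
  have key : ∀ a : ℤ, quadSum k ((a * h : ℤ)) r M =
      quadSum N (a * (h * u : ℤ)) r M * quadSum k1 (a * (h * w)) 0 1 := by
    intro a
    rw [quadSum_mul_of_coprime hk hcop hu hw, quadSum_of_isUnit _ _ hMu]
    push_cast
    rw [mul_assoc, mul_assoc]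
  have e1 := key 1
  have e2 := key 2
  have e4 := key 4
  have e8 := key 8
  push_cast at e1 e2 e4 e8 ⊢
  simp only [one_mul] at e1
  rw [e1, e2, e4, e8, ← quadSum_prod_of_odd hk1 hb]
  ring

theorem quadSum_prod_const {N : ℕ} [NeZero N] {b r M : ℤ}
    (h : ∀ v : ℤ, (N : ℤ) ∣ 2 * r * M * v + M ^ 2 * v ^ 2) :
    quadSum N b r M * quadSum N (2 * b) r M * quadSum N (4 * b) r M * quadSum N (8 * b) r M =
      N ^ 4 * ZMod.stdAddChar (15 * b * r ^ 2 : ZMod N) := by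
  have hv : ∀ (a : ZMod N) v, a * (2 * r * M * v + M ^ 2 * v ^ 2) = 0 := by
    intro a v
    obtain ⟨V, rfl⟩ := ZMod.intCast_surjective v
    have := (ZMod.intCast_zmod_eq_zero_iff_dvd _ _).2 (h V)
    push_cast at this
    rw [this, mul_zero]
  simp only [quadSum_const (hv _)]
  rw [show (15 * b * r ^ 2 : ZMod N) = b * r ^ 2 + 2 * b * r ^ 2 + 4 * b * r ^ 2 + 8 * b * r ^ 2 by
    ring]
  simp only [AddChar.map_add_eq_mul]
  ring

theorem quadSum_prod_gauss {N κ μ g0 M1 : ℕ} [NeZero N] [NeZero g0] (hN : N = 2 ^ κ * g0)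
    (hκ : 2 * μ + 5 ≤ κ) (hg0 : Odd g0) {b r0 : ℤ} (hb : Odd b) (hM1 : Odd M1) :
    quadSum N b (2 ^ μ * r0 : ℤ) (2 ^ μ * (g0 * M1) : ℤ) *
      quadSum N (2 * b) (2 ^ μ * r0 : ℤ) (2 ^ μ * (g0 * M1) : ℤ) *
      quadSum N (4 * b) (2 ^ μ * r0 : ℤ) (2 ^ μ * (g0 * M1) : ℤ) *
      quadSum N (8 * b) (2 ^ μ * r0 : ℤ) (2 ^ μ * (g0 * M1) : ℤ) =
      -2 ^ (2 * κ + 4 * μ + 5) * (g0 ^ 4 *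
        ZMod.stdAddChar (15 * (b * modInv (2 ^ κ) g0 : ℤ) * (2 ^ μ * r0 : ℤ) ^ 2 : ZMod g0)) := by
  have hcop : Nat.Coprime (2 ^ κ) g0 := Nat.Coprime.pow_left _ (Nat.coprime_two_left.2 hg0)
  have hu := modInv_mul_cancel (NeZero.ne (2 ^ κ)) hcop.symm
  have hw := modInv_mul_cancel (NeZero.ne g0) hcop
  set u : ℤ := ((modInv g0 (2 ^ κ) : ℕ) : ℤ)
  set w : ℤ := ((modInv (2 ^ κ) g0 : ℕ) : ℤ)
  have hodd : Odd u := by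
    have h2 : (2 : ℤ) ∣ u * g0 - 1 := by
      refine dvd_trans ?_ (modInv_mul_sub_one_dvd (NeZero.ne (2 ^ κ)) hcop.symm)
      push_cast
      exact dvd_pow_self 2 (by omega)
    have h3 : Odd (u * g0) := by
      obtain ⟨q, hq⟩ := h2
      exact ⟨q, by linear_combination hq⟩
    exact (Int.odd_mul.1 h3).1
  have hM0 : Odd ((g0 * M1 : ℕ) : ℤ) := by exact_mod_cast hg0.mul hM1
  have key : ∀ a : ℤ, quadSum N ((a * b : ℤ)) (2 ^ μ * r0 : ℤ) (2 ^ μ * (g0 * M1) : ℤ) =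
      quadSum (2 ^ κ) (a * (b * u : ℤ)) (2 ^ μ * r0) (2 ^ μ * ((g0 * M1 : ℕ) : ℤ)) *
        quadSum g0 (a * (b * w : ℤ)) (2 ^ μ * r0 : ℤ) (2 ^ μ * (g0 * M1) : ℤ) := by
    intro a
    rw [quadSum_mul_of_coprime hN hcop hu hw]
    push_cast
    rw [mul_assoc, mul_assoc]
  have hconst := quadSum_prod_const (N := g0) (b := b * w) (r := 2 ^ μ * r0)
    (M := 2 ^ μ * (g0 * M1)) fun v => ⟨2 * (2 ^ μ * r0) * (2 ^ μ * M1) * v +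
      2 ^ μ * 2 ^ μ * g0 * M1 ^ 2 * v ^ 2, by ring⟩
  rw [← hconst, ← quadSum_two_pow_scale_prod hκ (hb.mul hodd) r0 hM0]
  have e1 := key 1
  have e2 := key 2
  have e4 := key 4
  have e8 := key 8
  push_cast at e1 e2 e4 e8 ⊢
  simp only [one_mul] at e1
  rw [e1, e2, e4, e8]
  ring

/-- Cancel `d` from the fraction; an inverse modulo `N` is also an inverse modulo its divisor `n`.
-/
theorem stdAddChar_modInv_reduce {N n d a : ℕ} [NeZero N] [NeZero n] (hN : N = d * n)
    (ha : Nat.Coprime a N) {c x : ℤ} (hx : x = d * c) :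
    (ZMod.stdAddChar ((x * modInv a N : ℤ) : ZMod N) : ℂ) =
      Complex.exp (2 * Real.pi * Complex.I * c / n * modInv a n) := by
  have hnN : n ∣ N := ⟨d, by rw [hN, mul_comm]⟩
  have han : Nat.Coprime a n := ha.coprime_dvd_right hnN
  have h1 := (Int.natCast_dvd_natCast.2 hnN).trans (modInv_mul_sub_one_dvd (NeZero.ne N) ha)
  have h2 : (n : ℤ) ∣ (modInv a N - modInv a n : ℤ) * a := by
    convert Int.dvd_sub h1 (modInv_mul_sub_one_dvd (NeZero.ne n) han) using 1
    ring
  obtain ⟨q, hq⟩ := (Nat.isCoprime_iff_coprime.2 han).symm.dvd_of_dvd_mul_right h2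
  have hn0 : (n : ℂ) ≠ 0 := NeZero.ne _
  have hN0 : (N : ℂ) ≠ 0 := NeZero.ne _
  have hd0 : (d : ℂ) ≠ 0 := by
    rintro h0
    apply hN0
    rw [hN, Nat.cast_mul, h0, zero_mul]
  rw [ZMod.stdAddChar_coe, Complex.exp_eq_exp_iff_exists_int]
  refine ⟨c * q, ?_⟩
  have hq' : (modInv a N - modInv a n : ℂ) = n * q := by exact_mod_cast hq
  rw [hN] at hq' ⊢
  rw [hx]
  push_cast
  field_simp
  linear_combination (c : ℂ) * hq'

theorem dvd_two_mul_add_sq {κ μ ϱ : ℕ} {g r0 m : ℤ} (hr0 : Odd r0) (hm : Odd (g * m)) (hϱμ : ϱ ≤ μ)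
    (h : κ ≤ 2 * μ ∧ κ ≤ ϱ + μ + 1 ∨ κ = 2 * μ + 1 ∧ ϱ + 1 = μ) (v : ℤ) :
    2 ^ κ * g ∣ 2 * (2 ^ ϱ * r0) * (2 ^ μ * (g * m)) * v + (2 ^ μ * (g * m)) ^ 2 * v ^ 2 := by
  rcases h with ⟨h1, h2⟩ | ⟨h1, h2⟩
  · obtain ⟨a, ha⟩ := Nat.exists_eq_add_of_le h1
    obtain ⟨b, hb⟩ := Nat.exists_eq_add_of_le h2
    have p1 : (2 : ℤ) ^ μ * 2 ^ μ = 2 ^ κ * 2 ^ a := by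
      simp only [← pow_add]; congr 1; omega
    have p2 : 2 * ((2 : ℤ) ^ ϱ * 2 ^ μ) = 2 ^ κ * 2 ^ b := by
      simp only [← pow_add, ← pow_succ']; rw [hb]
    exact ⟨2 ^ b * r0 * m * v + 2 ^ a * g * m ^ 2 * v ^ 2, by
      linear_combination (r0 * g * m * v) * p2 + (g ^ 2 * m ^ 2 * v ^ 2) * p1⟩
  -- Each term alone is divisible only by `2^(2μ)`; the missing factor 2 comes from their sum, as
  -- `r0` and `g * m` are both odd.
  · have he : Even (v * (r0 + g * m * v)) := by
      rcases Int.even_or_odd v with hv | hv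
      · exact hv.mul_right _
      · exact (hr0.add_odd (hm.mul hv)).mul_left _
    obtain ⟨q, hq⟩ := he.two_dvd
    subst h1 h2
    refine ⟨m * q, ?_⟩
    rw [pow_succ (2 : ℤ) (2 * (ϱ + 1)), pow_mul']
    linear_combination (2 ^ (ϱ + 1) * 2 ^ (ϱ + 1) * g * m) * hq

/-! ### Assembly of the cases. -/

theorem corollary3p2
    (h r r0 : ℤ) (k k0 M M0 κ μ ϱ g0 g1 δ0 : ℕ)
    -- the decompositions `M = 2^μ M0`, `r = 2^ϱ r0`, `k = 2^κ k0` with odd `M0`, `r0`, `k0`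
    (hM : M = 2 ^ μ * M0) (hM0 : Odd M0)
    (hr : r = 2 ^ ϱ * r0) (hr0 : Odd r0)
    (hk : k = 2 ^ κ * k0) (hk0 : Odd k0)
    (hg0 : g0 = Nat.gcd M0 k0) (hg1 : g1 = Nat.gcd g0 (k0 / g0))
    (hδ0 : δ0 = min κ (2 * ϱ))
    (hhk : Int.gcd h (k : ℤ) = 1)
    (hMr : Int.gcd (M : ℤ) r = 1 ∨ Int.gcd (M : ℤ) r = 2 ∨ Int.gcd (M : ℤ) r = 4)
    (hϱμ : ϱ ≤ μ) :
    ((g1 ≠ 1 ∨ (ϱ : ℤ) < min (μ : ℤ) ((κ : ℤ) - (μ : ℤ)) - 1) →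
      Filter.Tendsto
        (fun z : ℝ => -((z : ℂ) ^ 2 *
          thetaSeries r M ![1, 2, 4, 8] ((h : ℂ) / (k : ℂ) + Complex.I * (z : ℂ) / (k : ℂ))))
        (nhdsWithin 0 (Set.Ioi 0)) (nhds 0)) ∧
    ((g1 = 1 ∧ min (μ : ℤ) ((κ : ℤ) - (μ : ℤ)) - 1 ≤ (ϱ : ℤ)) →
      Filter.Tendsto
        (fun z : ℝ => -((z : ℂ) ^ 2 *
          thetaSeries r M ![1, 2, 4, 8] ((h : ℂ) / (k : ℂ) + Complex.I * (z : ℂ) / (k : ℂ))))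
        (nhdsWithin 0 (Set.Ioi 0))
        (nhds
          (if κ ≤ 2 * μ ∨ (κ = 2 * μ + 1 ∧ (ϱ : ℤ) = (μ : ℤ) - 1) then
            -((2 : ℂ) ^ (2 * (κ : ℤ) - 4 * (μ : ℤ) - 5) / (M0 : ℂ) ^ 4) * (g0 : ℂ) ^ 2 *
              Complex.exp
                (2 * Real.pi * Complex.I * (h : ℂ) * (r0 : ℂ) ^ 2 /
                    ((2 : ℂ) ^ (κ - δ0) * (g0 : ℂ)) *
                  (2 : ℂ) ^ (2 * ϱ - δ0) * 15 * (modInv (k0 / g0) (2 ^ (κ - δ0) * g0) : ℂ))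
          else if 2 * μ + 5 ≤ κ ∧ ϱ = μ then
            (g0 : ℂ) ^ 2 / (M0 : ℂ) ^ 4 *
              Complex.exp
                (2 * Real.pi * Complex.I * (h : ℂ) * (r0 : ℂ) ^ 2 / (g0 : ℂ) * 15 *
                  (modInv (2 ^ (κ - 2 * μ) * (k0 / g0)) g0 : ℂ))
          else 0))) := by
  have hM00 : M0 ≠ 0 := hM0.pos.ne'
  have hk00 : k0 ≠ 0 := hk0.pos.ne'
  have hM' : M ≠ 0 := by rw [hM]; positivity
  have hk' : k ≠ 0 := by rw [hk]; positivity
  have : NeZero k := ⟨hk'⟩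
  have hg0pos : 0 < g0 := hg0 ▸ Nat.gcd_pos_of_pos_left _ hM0.pos
  have : NeZero g0 := ⟨hg0pos.ne'⟩
  obtain ⟨M1, hM1⟩ : g0 ∣ M0 := hg0 ▸ Nat.gcd_dvd_left _ _
  obtain ⟨k1, hk1⟩ : g0 ∣ k0 := hg0 ▸ Nat.gcd_dvd_right _ _
  have hdiv : k0 / g0 = k1 := by rw [hk1, Nat.mul_div_cancel_left _ hg0pos]
  rw [hdiv] at hg1 ⊢
  have hcop : M1.Coprime k1 := by
    rw [hM1, hk1, Nat.gcd_mul_left] at hg0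
    exact Nat.eq_of_mul_eq_mul_left hg0pos (by rw [mul_one]; exact hg0.symm)
  have hg0odd : Odd g0 := (Nat.odd_mul.1 (hM1 ▸ hM0)).1
  have hM1odd : Odd M1 := (Nat.odd_mul.1 (hM1 ▸ hM0)).2
  have hk1odd : Odd k1 := (Nat.odd_mul.1 (hk1 ▸ hk0)).2
  have : NeZero k1 := ⟨hk1odd.pos.ne'⟩
  have hMZ : ((M : ℕ) : ZMod k) = ((2 ^ μ * M0 : ℤ) : ZMod k) := by rw [hM]; push_cast; rfl
  have hlim := tendsto_sq_mul_thetaSeries h r (k := k) hM'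
  have hzero : quadSum k h r M = 0 ∨ quadSum k (2 * h) r M = 0 ∨ quadSum k (4 * h) r M = 0 ∨
      quadSum k (8 * h) r M = 0 →
      -((quadSum k h r M * quadSum k (2 * h) r M * quadSum k (4 * h) r M *
        quadSum k (8 * h) r M) / (32 * M ^ 4 * k ^ 2)) = 0 := by
    rintro (h0 | h0 | h0 | h0) <;> rw [h0] <;> simp
  constructor
  · intro hc
    rw [hzero] at hlim
    · exact hlim
    left
    by_cases hg : g1 = 1
    · have hlt := hc.resolve_left (not_not_intro hg)
      rw [hMZ, hr]
      exact quadSum_eq_zero_of_lt hM0 hr0 hk hhk (by omega) (by omega) (by omega)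
    · have hMr4 : Int.gcd M r ∣ 4 := by
        rcases hMr with h1 | h1 | h1 <;> rw [h1] <;> norm_num
      have := quadSum_eq_zero_of_gcd hM hM0 hk hM1 hk1 hcop hg1 hg hhk hMr4
      rwa [Int.cast_natCast] at this
  · rintro ⟨hg, hge⟩
    -- This is where `g1 = 1` enters: it allows `k1` to be split off.
    have hcopN : Nat.Coprime (2 ^ κ * g0) k1 :=
      Nat.Coprime.mul_left (Nat.Coprime.pow_left _ (Nat.coprime_two_left.2 hk1odd))
        (by rw [Nat.Coprime, ← hg1, hg])
    have hkN : k = 2 ^ κ * g0 * k1 := by rw [hk, hk1, mul_assoc]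
    have hMk1 : IsCoprime (2 ^ μ * M0 : ℤ) (k1 : ℤ) := by
      have : Nat.Coprime (2 ^ μ * M0) k1 := by
        rw [hM1]
        refine Nat.Coprime.mul_left (Nat.Coprime.pow_left _ (Nat.coprime_two_left.2 hk1odd))
          (Nat.Coprime.mul_left (by rw [Nat.Coprime, ← hg1, hg]) hcop)
      exact_mod_cast Nat.isCoprime_iff_coprime.2 this
    have hsplit := quadSum_prod_split hkN hcopN hk1odd (r := r)
      (Int.isCoprime_iff_gcd_eq_one.2 hhk) hMk1
    rw [← hMZ] at hsplit
    have hg0C : (g0 : ℂ) ≠ 0 := NeZero.ne _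
    have hk1C : (k1 : ℂ) ≠ 0 := NeZero.ne _
    have hM1C : (M1 : ℂ) ≠ 0 := by exact_mod_cast hM1odd.pos.ne'
    split_ifs with hA hB
    · have hδκ : δ0 ≤ κ := by omega
      have hδϱ : δ0 ≤ 2 * ϱ := by omega
      have hconst := quadSum_prod_const (N := 2 ^ κ * g0) (b := h * modInv k1 (2 ^ κ * g0)) (r := r)
        (M := 2 ^ μ * M0) ?_
      · rw [hsplit, hconst] at hlim
        convert hlim using 2
        have hphase := stdAddChar_modInv_reduce (N := 2 ^ κ * g0) (n := 2 ^ (κ - δ0) * g0)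
          (d := 2 ^ δ0) (c := 15 * h * r0 ^ 2 * 2 ^ (2 * ϱ - δ0)) (x := 15 * h * r ^ 2)
          (by rw [← mul_assoc, ← pow_add, Nat.add_sub_cancel' hδκ]) hcopN.symm
          (by
            have : (2 : ℤ) ^ δ0 * 2 ^ (2 * ϱ - δ0) = 2 ^ ϱ * 2 ^ ϱ := by
              simp only [← pow_add]; congr 1; omega
            rw [hr]
            push_cast
            linear_combination (-(15 * h * r0 ^ 2)) * this)
        rw [show (15 * ((h * modInv k1 (2 ^ κ * g0) : ℤ) : ZMod (2 ^ κ * g0)) * r ^ 2) =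
          ((15 * h * r ^ 2 * modInv k1 (2 ^ κ * g0) : ℤ) : ZMod (2 ^ κ * g0)) by push_cast; ring,
          hphase]
        have he : (2 * Real.pi * Complex.I * (h : ℂ) * (r0 : ℂ) ^ 2 /
              ((2 : ℂ) ^ (κ - δ0) * (g0 : ℂ)) *
              (2 : ℂ) ^ (2 * ϱ - δ0) * 15 * (modInv k1 (2 ^ (κ - δ0) * g0) : ℂ)) =
            2 * Real.pi * Complex.I * ((15 * h * r0 ^ 2 * 2 ^ (2 * ϱ - δ0) : ℤ) : ℂ) /
              ((2 ^ (κ - δ0) * g0 : ℕ) : ℂ) * (modInv k1 (2 ^ (κ - δ0) * g0) : ℂ) := by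
          push_cast
          field_simp
        rw [he, hkN, hM, hM1]
        have hz : (2 : ℂ) ^ (2 * (κ : ℤ) - 4 * (μ : ℤ) - 5) = (2 ^ κ) ^ 2 / (2 ^ μ) ^ 4 / 32 := by
          rw [zpow_sub₀ two_ne_zero, zpow_sub₀ two_ne_zero, ← pow_mul', ← pow_mul']
          norm_cast
        rw [hz]
        push_cast
        field_simp
      · intro v
        rw [hr, hM1]
        push_cast
        refine dvd_two_mul_add_sq hr0 (by exact_mod_cast hM1 ▸ hM0) hϱμ ?_ v
        omega
    · obtain ⟨hκ, rfl⟩ := hB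
      have hhodd := Int.odd_of_gcd_two_pow_mul_eq_one hk (by omega) hhk
      have hbodd : Odd (h * (modInv k1 (2 ^ κ * g0) : ℤ)) := by
        have h2 : (2 : ℤ) ∣ (modInv k1 (2 ^ κ * g0) : ℤ) * k1 - 1 := by
          refine dvd_trans ?_ (modInv_mul_sub_one_dvd (NeZero.ne (2 ^ κ * g0)) hcopN.symm)
          push_cast
          exact (dvd_pow_self 2 (by omega)).mul_right _
        obtain ⟨q, hq⟩ := h2
        have hodd : Odd ((modInv k1 (2 ^ κ * g0) : ℤ) * k1) := ⟨q, by linear_combination hq⟩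
        exact hhodd.mul (Int.odd_mul.1 hodd).1
      have hgauss := quadSum_prod_gauss (N := 2 ^ κ * g0) rfl hκ hg0odd (r0 := r0) hbodd hM1odd
      have hMZ' : (2 ^ ϱ * (g0 * M1) : ℤ) = 2 ^ ϱ * M0 := by rw [hM1]; push_cast; rfl
      rw [hMZ', ← hr] at hgauss
      rw [hsplit, hgauss] at hlim
      convert hlim using 2
      have hcopg : Nat.Coprime k1 g0 := hcopN.symm.coprime_dvd_right (dvd_mul_left _ _)
      have hcop2 : ∀ n, Nat.Coprime (2 ^ n) g0 := fun n =>
        Nat.Coprime.pow_left _ (Nat.coprime_two_left.2 hg0odd)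
      have i1 : (modInv k1 (2 ^ κ * g0) * k1 : ZMod g0) = 1 := by
        have := (Int.natCast_dvd_natCast.2 (dvd_mul_left g0 (2 ^ κ))).trans
          (modInv_mul_sub_one_dvd (NeZero.ne (2 ^ κ * g0)) hcopN.symm)
        rw [← ZMod.intCast_zmod_eq_zero_iff_dvd] at this
        push_cast at this
        exact sub_eq_zero.1 this
      have i2 := modInv_mul_cancel (NeZero.ne g0) (hcop2 κ)
      have i3 := modInv_mul_cancel (NeZero.ne g0)
        (Nat.Coprime.mul_left (hcop2 (κ - 2 * ϱ)) hcopg)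
      -- The factor `(2^ϱ)^2` of `r^2` cancels against the inverse of `2^κ`, leaving an inverse of
      -- `2^(κ-2ϱ)`.
      have p : (2 : ZMod g0) ^ κ = 2 ^ (κ - 2 * ϱ) * (2 ^ ϱ * 2 ^ ϱ) := by
        simp only [← pow_add]; congr 1; omega
      push_cast at i2 i3
      rw [p] at i2
      have hw : (15 * ((h * modInv k1 (2 ^ κ * g0) * modInv (2 ^ κ) g0 : ℤ) : ZMod g0) * r ^ 2) =
          ((15 * h * r0 ^ 2 * modInv (2 ^ (κ - 2 * ϱ) * k1) g0 : ℤ) : ZMod g0) := by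
        rw [hr]
        push_cast
        generalize (modInv k1 (2 ^ κ * g0) : ZMod g0) = A at *
        generalize (modInv (2 ^ κ) g0 : ZMod g0) = B at *
        generalize (modInv (2 ^ (κ - 2 * ϱ) * k1) g0 : ZMod g0) = C at *
        generalize (2 : ZMod g0) ^ (κ - 2 * ϱ) = D at *
        generalize (2 : ZMod g0) ^ ϱ = E at *
        linear_combination (15 * h * r0 ^ 2 : ZMod g0) *
          (-(A * B * E ^ 2) * i3 + C * (B * D * E ^ 2) * i1 + C * i2)
      rw [hw, ZMod.stdAddChar_coe]
      have he : (2 * Real.pi * Complex.I * (h : ℂ) * (r0 : ℂ) ^ 2 / (g0 : ℂ) * 15 *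
            (modInv (2 ^ (κ - 2 * ϱ) * k1) g0 : ℂ)) =
          2 * Real.pi * Complex.I *
            ((15 * h * r0 ^ 2 * modInv (2 ^ (κ - 2 * ϱ) * k1) g0 : ℤ) : ℂ) / (g0 : ℂ) := by
        push_cast
        field_simp
      have h2 : (2 : ℂ) ^ (2 * κ + 4 * ϱ + 5) = 32 * (2 ^ κ) ^ 2 * (2 ^ ϱ) ^ 4 := by
        rw [pow_add, pow_add, pow_mul', pow_mul']; ring
      rw [he, h2, hkN, hM, hM1]
      push_cast
      field_simp
    · rw [hzero] at hlim
      · exact hlim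
      by_cases hϱ : ϱ = μ
      · subst hϱ
        -- For `2ϱ+1 ≤ κ ≤ 2ϱ+4` exactly one coefficient `2^β * h` of the four has the exponent
        -- required by `quadSum_eq_zero_of_eq`.
        have hβ : ∃ β, β < 4 ∧ κ = 2 * ϱ + 1 + β := ⟨κ - (2 * ϱ + 1), by omega, by omega⟩
        obtain ⟨β, hβ4, hβ⟩ := hβ
        have h0 := quadSum_eq_zero_of_eq (r0 := r0) hM0 hk hk0 hhk hβ
        rw [← hMZ, ← hr] at h0
        interval_cases β <;> norm_num at h0 <;> simp [h0]
      -- The remaining case is `ϱ = μ - 1` and `κ ≥ 2μ + 2`.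
      · left
        rw [hMZ, hr]
        exact quadSum_eq_zero_of_lt hM0 hr0 hk hhk (by omega) (by omega) (by omega)
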